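/- **Theorem 9.1.** Let $A\in\mathbb{R}^{n\times n}$ and $B\in\mathbb{R}^{n\times r}$ with $\operatorname{rank}B=r$, and suppose that the pair $(A,B)$ is controllable, i.e. for all $t_0<t_1$ and all $x_0,x_1\in\mathbb{R}^n$ some continuous control $u$ steers $\dot x=Ax+Bu$ from $x(t_0)=x_0$ to $x(t_1)=x_1$. Let $\bar s_1,\dots,\bar s_{n-r}$ be distinct real numbers, none of which is an eigenvalue of $A$. For $C\in\mathbb{R}^{r\times n}$ put $$P(s)=\begin{pmatrix} sI_n-A & -B\\ C & 0\end{pmatrix}.$$ Then there exists $C\in\mathbb{R}^{r\times n}$ such that 1. the zero polynomial $\det P(s)$ of the square system $\dot x=Ax+Bu$, $y=Cx$ equals $k\prod_{i=1}^{n-r}(s-\bar s_i)$ for some real constant $k\neq 0$, and the set of system zeros $\{z\in\mathbb{C} : \operatorname{rank}P(z)<n+r\}$ is exactly $\{\bar s_1,\dots,\bar s_{n-r}\}$; 2. the pair $(A,C)$ is observable, i.e. for all $t_0<t_1$, two solutions of $\dot x=Ax+Bu$ on $[t_0,t_1]$ with the same continuous input $u$ and the same output $y=Cx$ on $[t_0,t_1]$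 coincide there; 3. $\operatorname{rank}C=r$ and $\operatorname{rank}(CB)=r$. -/

import Mathlib

open Polynomial

/-- `x` solves the state equation `x' = A x + B u` on `[t₀, t₁]` for the continuous input `u`
(one-sided derivatives at the end points). -/
def IsTrajectory {n r : ℕ} (A : Matrix (Fin n) (Fin n) ℝ) (B : Matrix (Fin n) (Fin r) ℝ)
    (t₀ t₁ : ℝ) (u : ℝ → Fin r → ℝ) (x : ℝ → Fin n → ℝ) : Prop :=
  ContinuousOn u (Set.Icc t₀ t₁) ∧
    ∀ t ∈ Set.Icc t₀ t₁,
      HasDerivWithinAt x (A.mulVec (x t) + B.mulVec (u t)) (Set.Icc t₀ t₁) t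

/-- Complete state controllability of the pair `(A, B)`: on every time interval, every initial
state can be steered to every final state by some control. -/
def IsControllable {n r : ℕ} (A : Matrix (Fin n) (Fin n) ℝ) (B : Matrix (Fin n) (Fin r) ℝ) :
    Prop :=
  ∀ t₀ t₁ : ℝ, t₀ < t₁ → ∀ x₀ x₁ : Fin n → ℝ,
    ∃ (u : ℝ → Fin r → ℝ) (x : ℝ → Fin n → ℝ),
      IsTrajectory A B t₀ t₁ u x ∧ x t₀ = x₀ ∧ x t₁ = x₁

/-- Complete state observability of the system `x' = A x + B u`, `y = C x`: on every time interval,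
the state is determined by the input and the output. (Subtracting two trajectories with
the same input shows that this depends on the pair `(A, C)` only.) -/
def IsObservable {n r l : ℕ} (A : Matrix (Fin n) (Fin n) ℝ) (B : Matrix (Fin n) (Fin r) ℝ)
    (C : Matrix (Fin l) (Fin n) ℝ) : Prop :=
  ∀ t₀ t₁ : ℝ, t₀ < t₁ → ∀ (u : ℝ → Fin r → ℝ) (x x' : ℝ → Fin n → ℝ),
    IsTrajectory A B t₀ t₁ u x → IsTrajectory A B t₀ t₁ u x' →
    (∀ t ∈ Set.Icc t₀ t₁, C.mulVec (x t) = C.mulVec (x' t)) →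
    ∀ t ∈ Set.Icc t₀ t₁, x t = x' t

/-- Rosenbrock's system matrix `P(s) = [sI - A, -B; C, 0]`, a polynomial matrix. -/
noncomputable def systemMatrix {n r l : ℕ} (A : Matrix (Fin n) (Fin n) ℝ)
    (B : Matrix (Fin n) (Fin r) ℝ) (C : Matrix (Fin l) (Fin n) ℝ) :
    Matrix (Fin n ⊕ Fin l) (Fin n ⊕ Fin r) ℝ[X] :=
  Matrix.fromBlocks
    (Matrix.scalar (Fin n) (X : ℝ[X]) - A.map Polynomial.C) (-(B.map Polynomial.C))
    (C.map Polynomial.C) 0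

/-- The system zeros: the complex frequencies `z` with `rank P(z) < n + min r l`. -/
def systemZeros {n r l : ℕ} (A : Matrix (Fin n) (Fin n) ℝ) (B : Matrix (Fin n) (Fin r) ℝ)
    (C : Matrix (Fin l) (Fin n) ℝ) : Set ℂ :=
  {z | ((systemMatrix A B C).map (fun p => Polynomial.aeval z p)).rank < n + min r l}

/-- The zero polynomial `det P(s) = det(sI - A) * det(C (sI - A)⁻¹ B)` of a square system (as usual,
only its roots with multiplicities matter, that is, the polynomial up to a nonzero constant). -/
noncomputable def zeroPolynomial {n r : ℕ} (A : Matrix (Fin n) (Fin n) ℝ)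
    (B : Matrix (Fin n) (Fin r) ℝ) (C : Matrix (Fin r) (Fin n) ℝ) : ℝ[X] :=
  (systemMatrix A B C).det

/-! The zeros of a square system with `C B` invertible are governed by `ker C`. If `ker C` is
spanned by vectors `v i` with `A (v i) = s i • v i - B (u i)`, then `(v i, u i)` lies in the
kernel of the system matrix at `s i`; as soon as the `v i` together with the columns of `B` form a basis,
one column operation turns `P(X)` into a block triangular matrix whose determinant is a constant
times `∏ (X - s i)` (`systemMatrix_det_mul`). So it suffices to choose such `v i` linearly
independent modulo `range B`, and to let `C` vanish on them and satisfy `C B = 1`.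

The choice is greedy (`exists_linearIndependent_mkQ`). Suppose that `v 0, …, v (k-1)` are chosen and
let `W` be their span plus `range B`. If every solution `x` of `A x = s • x - B u` lay in `W`, then
`A - s` would map `W` onto `W`: the resolvent identity gives preimages of the `v i`, because the
numbers are distinct, and `B u` has a preimage because `s` is not an eigenvalue. Hence `W` would be
`A`-invariant, which controllability allows only for the whole space
(`IsControllable.eq_top_of_invariant`), and this needs `k + r ≥ n`.

For observability, the unobservable subspace is `A`-invariant and contained in the span of the
`v i`. On it `A` acts diagonally with entries `s i`, none of which is an eigenvalue of `A`, so it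
is zero (`eq_zero_of_mem_invariant`). -/

open Module

/-! ### Controllability and invariant subspaces -/

/-- The only `A`-invariant subspace containing the range of `B` is the whole space: a trajectory
starting in such a subspace `W` stays in it, since its projection along `W` solves a linear
differential equation with zero initial value. -/
theorem IsControllable.eq_top_of_invariant {n r : ℕ} {A : Matrix (Fin n) (Fin n) ℝ}
    {B : Matrix (Fin n) (Fin r) ℝ} (h : IsControllable A B) (W : Submodule ℝ (Fin n → ℝ))
    (hA : ∀ x ∈ W, A.mulVec x ∈ W) (hB : ∀ u, B.mulVec u ∈ W) : W = ⊤ := by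
  obtain ⟨W', hW⟩ := Submodule.exists_isCompl W
  -- `Q` is the projection with kernel `W` and range `W'`.
  let Q : (Fin n → ℝ) →ₗ[ℝ] (Fin n → ℝ) := W'.projection W hW.symm
  have hQ0 : ∀ x, Q x = 0 ↔ x ∈ W := fun x =>
    Submodule.projection_apply_eq_zero_iff hW.symm
  have hQQ : ∀ x, Q (Q x) = Q x := fun x => by simp [Q]
  let L : (Fin n → ℝ) →L[ℝ] (Fin n → ℝ) := (Q ∘ₗ A.mulVecLin).toContinuousLinearMap
  refine eq_top_iff.2 fun x₁ _ => ?_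
  obtain ⟨u, x, hx, h0, h1⟩ := h 0 1 one_pos 0 x₁
  have hd : ∀ t ∈ Set.Icc (0 : ℝ) 1,
      HasDerivWithinAt (fun t => Q (x t)) (L (Q (x t))) (Set.Icc 0 1) t := by
    intro t ht
    have h2 := Q.toContinuousLinearMap.hasFDerivAt.comp_hasDerivWithinAt t (hx.2 t ht)
    have h3 : Q (A.mulVec (x t) + B.mulVec (u t)) = Q (A.mulVec (Q (x t))) := by
      rw [map_add, (hQ0 _).2 (hB _), add_zero, ← sub_eq_zero, ← map_sub, ← Matrix.mulVec_sub]
      refine (hQ0 _).2 (hA _ ((hQ0 _).1 ?_))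
      rw [map_sub, hQQ, sub_self]
    exact h2.congr_deriv h3
  have huniq := ODE_solution_unique_of_mem_Icc_right
    (v := fun _ => L) (s := fun _ => Set.univ) (K := ‖L‖₊) (a := 0) (b := 1)
    (f := fun t => Q (x t)) (g := fun _ => 0)
    (fun t _ => L.lipschitz.lipschitzOnWith) (fun t ht => (hd t ht).continuousWithinAt)
    (fun t ht => (hd t (Set.Ico_subset_Icc_self ht)).mono_of_mem_nhdsWithin
      (Icc_mem_nhdsGE_of_mem ht)) (fun _ _ => trivial) continuousOn_const
    (fun t _ => by simpa using hasDerivWithinAt_const t (Set.Ici t) (0 : Fin n → ℝ))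
    (fun _ _ => trivial) (by simp [h0])
  have : Q (x 1) = 0 := huniq (Set.right_mem_Icc.2 zero_le_one)
  rwa [h1, hQ0] at this

/-! ### Choice of the kernel vectors -/

section Abstract

variable {K E F : Type*} [Field K] [AddCommGroup E] [Module K E] [AddCommGroup F] [Module K F]

/-- The induction step of the greedy choice: some solution of `A x = μ • x - B u` lies outside
`range B ⊔ span (range v)`. -/
theorem exists_notMem_range_sup_span [FiniteDimensional K E] {A : E →ₗ[K] E} {B : F →ₗ[K] E}
    (hc : ∀ W : Submodule K E, (∀ x ∈ W, A x ∈ W) → (∀ u, B u ∈ W) → W = ⊤)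
    {ι : Type*} {s : ι → K} {v : ι → E} {u : ι → F} (hv : ∀ i, A (v i) = s i • v i - B (u i))
    {μ : K} (hμ : ∀ x, A x = μ • x → x = 0) (hs : ∀ i, s i ≠ μ)
    (hW : LinearMap.range B ⊔ Submodule.span K (Set.range v) ≠ ⊤) :
    ∃ x w, A x = μ • x - B w ∧ x ∉ LinearMap.range B ⊔ Submodule.span K (Set.range v) := by
  by_contra! hcon
  set W := LinearMap.range B ⊔ Submodule.span K (Set.range v) with hWdef
  have hBW : ∀ w, B w ∈ W := fun w => Submodule.mem_sup_left ⟨w, rfl⟩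
  have hvW : ∀ i, v i ∈ W := fun i =>
    Submodule.mem_sup_right (Submodule.subset_span ⟨i, rfl⟩)
  set T : E →ₗ[K] E := A - μ • LinearMap.id with hT
  have hTx : ∀ x, T x = A x - μ • x := fun x => by simp [hT]
  have hinj : Function.Injective T := (injective_iff_map_eq_zero T).2 fun x hx =>
    hμ x (sub_eq_zero.1 (by rwa [hTx] at hx))
  have hTB : ∀ w, ∃ y ∈ W, T y = B w := by
    intro w
    obtain ⟨y, hy⟩ := LinearMap.injective_iff_surjective.1 hinj (B w)
    refine ⟨y, hcon y (-w) ?_, hy⟩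
    rw [hTx] at hy
    rw [map_neg, ← hy]
    abel
  have hle : W ≤ W.map T := by
    refine sup_le ?_ (Submodule.span_le.2 ?_)
    · rintro _ ⟨w, rfl⟩
      exact hTB w
    · rintro _ ⟨i, rfl⟩
      obtain ⟨y, hy, hTy⟩ := hTB (u i)
      refine ⟨(s i - μ)⁻¹ • (v i + y), W.smul_mem _ (W.add_mem (hvW i) hy), ?_⟩
      rw [map_smul, map_add, hTy, hTx, hv, inv_smul_eq_iff₀ (sub_ne_zero.2 (hs i)), sub_smul]
      abel
  have heq : W = W.map T := Submodule.eq_of_le_of_finrank_le hle (Submodule.finrank_map_le T W)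
  refine hW (hc W (fun x hx => ?_) hBW)
  have hmem : T x ∈ W := by
    rw [heq]
    exact ⟨x, hx, rfl⟩
  have := W.add_mem hmem (W.smul_mem μ hx)
  rwa [hTx, sub_add_cancel] at this

/-- Vectors `v i` with `A (v i) = s i • v i - B (u i)` can be chosen linearly independent modulo
`range B`, for at most `finrank E - finrank (range B)` distinct numbers `s i`. -/
theorem exists_linearIndependent_mkQ [FiniteDimensional K E] {A : E →ₗ[K] E} {B : F →ₗ[K] E}
    (hc : ∀ W : Submodule K E, (∀ x ∈ W, A x ∈ W) → (∀ u, B u ∈ W) → W = ⊤)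
    (k : ℕ) (hk : finrank K (LinearMap.range B) + k ≤ finrank K E)
    (s : Fin k → K) (hs : Function.Injective s) (hA : ∀ i x, A x = s i • x → x = 0) :
    ∃ (v : Fin k → E) (u : Fin k → F), (∀ i, A (v i) = s i • v i - B (u i)) ∧
      LinearIndependent K (fun i => (LinearMap.range B).mkQ (v i)) := by
  induction k with
  | zero => exact ⟨Fin.elim0, Fin.elim0, fun i => i.elim0, linearIndependent_empty_type⟩
  | succ k ih =>
    obtain ⟨v, u, hv, hli⟩ := ih (by omega) (fun i => s i.succ)
      (hs.comp (Fin.succ_injective k)) (fun i => hA i.succ)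
    have hne : LinearMap.range B ⊔ Submodule.span K (Set.range v) ≠ ⊤ := by
      intro htop
      have h1 := Submodule.finrank_add_le_finrank_add_finrank (LinearMap.range B)
        (Submodule.span K (Set.range v))
      have h2 := finrank_range_le_card (R := K) v
      rw [Set.finrank, Fintype.card_fin] at h2
      rw [htop, finrank_top] at h1
      omega
    obtain ⟨x, w, hx, hxW⟩ := exists_notMem_range_sup_span hc hv (hA 0)
      (fun i => hs.ne (Fin.succ_ne_zero i)) hne
    refine ⟨Fin.cons x v, Fin.cons w u, fun i => Fin.cases (by simpa using hx)
      (fun j => by simpa using hv j) i, ?_⟩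
    have hcons : (fun i => (LinearMap.range B).mkQ ((Fin.cons x v : Fin (k + 1) → E) i)) =
        Fin.cons ((LinearMap.range B).mkQ x) (fun i => (LinearMap.range B).mkQ (v i)) := by
      funext i
      exact Fin.cases rfl (fun j => rfl) i
    rw [hcons, linearIndependent_finCons]
    refine ⟨hli, fun hmem => hxW ?_⟩
    have hrange : Set.range (fun i => (LinearMap.range B).mkQ (v i)) =
        (LinearMap.range B).mkQ '' Set.range v := by
      rw [← Set.range_comp]
      rfl
    rw [hrange, ← Submodule.map_span, ← Submodule.mem_comap, Submodule.comap_map_mkQ] at hmem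
    exact hmem

/-! ### The unobservable subspace -/

/-- An `A`-invariant subspace of `ker C` meets the span of the `v i` trivially: applying `A - s j`
stays in the subspace and removes `v j` from a linear combination, and `A - s j` is injective. -/
theorem eq_zero_of_mem_invariant {A : E →ₗ[K] E} {B : F →ₗ[K] E} {C : E →ₗ[K] F}
    {ι : Type*} {s : ι → K} {v : ι → E} {u : ι → F} (hA : ∀ i x, A x = s i • x → x = 0)
    (hv : ∀ i, A (v i) = s i • v i - B (u i)) (hCv : ∀ i, C (v i) = 0)
    (hCB : ∀ w, C (B w) = w) {N : Submodule K E} (hN : ∀ x ∈ N, A x ∈ N) (hNC : ∀ x ∈ N, C x = 0)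
    (J : Finset ι) (c : ι → K) (hJ : ∑ i ∈ J, c i • v i ∈ N) : ∑ i ∈ J, c i • v i = 0 := by
  classical
  induction J using Finset.induction_on generalizing c with
  | empty => simp
  | insert j J hj ih =>
    set x := ∑ i ∈ insert j J, c i • v i with hx
    have hmem : A x - s j • x ∈ N := N.sub_mem (hN x hJ) (N.smul_mem _ hJ)
    have hexp : A x - s j • x =
        ∑ i ∈ J, (c i * (s i - s j)) • v i - B (∑ i ∈ insert j J, c i • u i) := by
      have : A x - s j • x = ∑ i ∈ insert j J, ((c i * (s i - s j)) • v i - B (c i • u i)) := by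
        rw [hx, map_sum, Finset.smul_sum, ← Finset.sum_sub_distrib]
        refine Finset.sum_congr rfl fun i _ => ?_
        rw [map_smul, hv, map_smul]
        module
      rw [this, Finset.sum_sub_distrib, map_sum]
      congr 1
      rw [Finset.sum_insert hj]
      simp
    have hzero : ∑ i ∈ insert j J, c i • u i = 0 := by
      have h1 := hNC _ hmem
      rw [hexp, map_sub, hCB, map_sum, sub_eq_zero] at h1
      rw [← h1]
      exact Finset.sum_eq_zero fun i _ => by rw [map_smul, hCv, smul_zero]
    rw [hzero, map_zero, sub_zero] at hexp
    rw [hexp] at hmem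
    rw [ih _ hmem] at hexp
    exact hA j x (sub_eq_zero.1 hexp)

end Abstract

/-- If a free motion `e` stays in `ker L`, so does its velocity `A e`, also at the end points. -/
theorem map_velocity_eq_zero {n : ℕ} {A : Matrix (Fin n) (Fin n) ℝ} {t₀ t₁ : ℝ} (ht : t₀ < t₁)
    {e : ℝ → Fin n → ℝ}
    (he : ∀ t ∈ Set.Icc t₀ t₁, HasDerivWithinAt e (A.mulVec (e t)) (Set.Icc t₀ t₁) t)
    {G : Type*} [NormedAddCommGroup G] [NormedSpace ℝ G] (L : (Fin n → ℝ) →ₗ[ℝ] G)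
    (hL : ∀ t ∈ Set.Icc t₀ t₁, L (e t) = 0) : ∀ t ∈ Set.Icc t₀ t₁, L (A.mulVec (e t)) = 0 := by
  intro t htt
  have h1 := L.toContinuousLinearMap.hasFDerivAt.comp_hasDerivWithinAt t (he t htt)
  have h2 : HasDerivWithinAt (L.toContinuousLinearMap ∘ e) 0 (Set.Icc t₀ t₁) t :=
    (hasDerivWithinAt_const t _ (0 : G)).congr hL (hL t htt)
  exact (uniqueDiffOn_Icc ht t htt).eq_deriv _ h1 h2

/-- Observability follows when every `A`-invariant subspace of `ker C` is zero. -/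
theorem isObservable_of_invariant {n r l : ℕ} {A : Matrix (Fin n) (Fin n) ℝ}
    {B : Matrix (Fin n) (Fin r) ℝ} {C : Matrix (Fin l) (Fin n) ℝ}
    (h : ∀ N : Submodule ℝ (Fin n → ℝ), (∀ x ∈ N, A.mulVec x ∈ N) →
      (∀ x ∈ N, C.mulVec x = 0) → ∀ x ∈ N, x = 0) : IsObservable A B C := by
  intro t₀ t₁ ht u x x' hx hx' hy t htt
  have he : ∀ t ∈ Set.Icc t₀ t₁, HasDerivWithinAt (x - x') (A.mulVec ((x - x') t))
      (Set.Icc t₀ t₁) t := fun t ht => by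
    have h1 := (hx.2 t ht).sub (hx'.2 t ht)
    rwa [add_sub_add_right_eq_sub, ← Matrix.mulVec_sub] at h1
  have hk : ∀ k : ℕ, ∀ t ∈ Set.Icc t₀ t₁,
      (C.mulVecLin ∘ₗ A.mulVecLin ^ k) ((x - x') t) = 0 := by
    intro k
    induction k with
    | zero => exact fun t ht => by simp [Matrix.mulVec_sub, hy t ht]
    | succ k ih =>
      intro t htt
      have := map_velocity_eq_zero ht he _ ih t htt
      simpa [pow_succ] using this
  refine sub_eq_zero.1 (h (⨅ k : ℕ, LinearMap.ker (C.mulVecLin ∘ₗ A.mulVecLin ^ k)) ?_ ?_ _ ?_)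
  · intro y hyN
    simp only [Submodule.mem_iInf, LinearMap.mem_ker] at hyN ⊢
    intro k
    simpa [pow_succ] using hyN (k + 1)
  · intro y hyN
    simp only [Submodule.mem_iInf, LinearMap.mem_ker] at hyN
    simpa using hyN 0
  · simp only [Submodule.mem_iInf, LinearMap.mem_ker]
    exact fun k => hk k t htt

/-! ### The zero polynomial -/

/-- With `T = [V, B]` and `R = [V, 0, B; U, -1, 0]`, the product `P(X) R` is block upper triangular
with diagonal blocks `[V (X - diag s), B]` and `1`. The equivalence `e` puts the columns of `V` and
of `B` into one square matrix. -/
theorem systemMatrix_det_mul {n r : ℕ} {ι : Type*} [Fintype ι] {A : Matrix (Fin n) (Fin n) ℝ}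
    {B : Matrix (Fin n) (Fin r) ℝ} {C : Matrix (Fin r) (Fin n) ℝ} (e : ι ⊕ Fin r ≃ Fin n)
    {s : ι → ℝ} {V : Matrix (Fin n) ι ℝ} {U : Matrix (Fin r) ι ℝ}
    (hV : ∀ i j, (A * V) i j = s j * V i j - (B * U) i j) (hCV : C * V = 0) (hCB : C * B = 1) :
    (systemMatrix A B C).det * Polynomial.C (Matrix.fromBlocks
        ((Matrix.fromCols V 0).submatrix id e.symm) B
        ((Matrix.fromCols U (-1)).submatrix id e.symm) 0).det =
      Polynomial.C ((Matrix.fromCols V B).submatrix id e.symm).det *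
        ∏ i, (Polynomial.X - Polynomial.C (s i)) := by
  set V₁ : Matrix (Fin n) (Fin n) ℝ := (Matrix.fromCols V 0).submatrix id e.symm with hV₁
  set U₁ : Matrix (Fin r) (Fin n) ℝ := (Matrix.fromCols U (-1)).submatrix id e.symm with hU₁
  set T : Matrix (Fin n) (Fin n) ℝ := (Matrix.fromCols V B).submatrix id e.symm with hT
  have hCV₁ : C * V₁ = 0 := by
    ext i j
    obtain ⟨j, rfl⟩ := e.surjective j
    have h0 := congrFun (congrFun hCV i)
    rcases j with j | j
    · simpa [hV₁, Matrix.mul_apply] using h0 j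
    · simp [hV₁, Matrix.mul_apply]
  let d : Fin n → ℝ[X] := fun j =>
    Sum.elim (fun i => Polynomial.X - Polynomial.C (s i)) (fun _ => 1) (e.symm j)
  have hblock : (Matrix.scalar (Fin n) (Polynomial.X : ℝ[X]) - A.map Polynomial.C) *
      V₁.map Polynomial.C - B.map Polynomial.C * U₁.map Polynomial.C =
      T.map Polynomial.C * Matrix.diagonal d := by
    rw [Matrix.sub_mul, ← Matrix.map_mul, ← Matrix.map_mul]
    ext1 i j
    obtain ⟨j, rfl⟩ := e.surjective j
    rw [Matrix.sub_apply, Matrix.sub_apply, Matrix.mul_diagonal, Matrix.scalar_apply,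
      Matrix.diagonal_mul]
    rcases j with j | j
    · have h1 : (A * V₁) i (e (Sum.inl j)) = (A * V) i j := by simp [hV₁, Matrix.mul_apply]
      have h2 : (B * U₁) i (e (Sum.inl j)) = (B * U) i j := by simp [hU₁, Matrix.mul_apply]
      simp only [Matrix.map_apply, h1, h2, hV i j]
      simp [d, hV₁, hT]
      ring
    · have h1 : (A * V₁) i (e (Sum.inr j)) = 0 := by simp [hV₁, Matrix.mul_apply]
      have h2 : (B * U₁) i (e (Sum.inr j)) = -B i j := by
        simp [hU₁, Matrix.mul_apply, Matrix.one_apply]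
      simp only [Matrix.map_apply, h1, h2]
      simp [d, hV₁, hT]
  have hprod : systemMatrix A B C * (Matrix.fromBlocks V₁ B U₁ 0).map Polynomial.C =
      Matrix.fromBlocks (T.map Polynomial.C * Matrix.diagonal d)
        ((Matrix.scalar (Fin n) (Polynomial.X : ℝ[X]) - A.map Polynomial.C) *
          B.map Polynomial.C) 0 1 := by
    rw [systemMatrix, Matrix.fromBlocks_map, Matrix.fromBlocks_multiply, ← hblock]
    congr 1
    · rw [Matrix.neg_mul, ← sub_eq_add_neg]
    · simp
    · rw [← Matrix.map_mul, hCV₁]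
      simp
    · rw [← Matrix.map_mul, hCB]
      simp
  have hdet := congrArg Matrix.det hprod
  have hd : ∏ j, d j = ∏ i, (Polynomial.X - Polynomial.C (s i)) := by
    rw [← e.prod_comp, Fintype.prod_sum_type]
    simp [d]
  rw [Matrix.det_mul, Matrix.det_fromBlocks_zero₂₁, Matrix.det_one, mul_one, Matrix.det_mul,
    Matrix.det_diagonal, hd] at hdet
  have hmap : ∀ {m : Type} [Fintype m] [DecidableEq m] (M : Matrix m m ℝ),
      (M.map Polynomial.C).det = Polynomial.C M.det := fun M =>
    ((Polynomial.C : ℝ →+* ℝ[X]).map_det M).symm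
  rwa [hmap, hmap] at hdet

/-- The system zeros of a square system are the complex roots of its zero polynomial. -/
theorem mem_systemZeros_iff {n r : ℕ} {A : Matrix (Fin n) (Fin n) ℝ}
    {B : Matrix (Fin n) (Fin r) ℝ} {C : Matrix (Fin r) (Fin n) ℝ} {z : ℂ} :
    z ∈ systemZeros A B C ↔ Polynomial.aeval z (zeroPolynomial A B C) = 0 := by
  set M := (systemMatrix A B C).map (fun p => Polynomial.aeval z p) with hM
  have hdet : M.det = Polynomial.aeval z (zeroPolynomial A B C) :=
    ((Polynomial.aeval (R := ℝ) z).toRingHom.map_det (systemMatrix A B C)).symm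
  have hcard : Fintype.card (Fin n ⊕ Fin r) = n + min r r := by simp
  change M.rank < n + min r r ↔ _
  rw [← hdet, ← hcard]
  constructor
  · intro h
    by_contra hne
    exact h.ne (Matrix.rank_of_isUnit M ((Matrix.isUnit_iff_isUnit_det M).2 (Ne.isUnit hne)))
  · intro h
    refine lt_of_le_of_ne (Matrix.rank_le_card_width M) fun hr => ?_
    obtain ⟨w, hw, hMw⟩ := Matrix.exists_mulVec_eq_zero_iff.2 h
    have hker := M.mulVecLin.finrank_range_add_finrank_ker
    rw [Module.finrank_fintype_fun_eq_card] at hker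
    have h0 : finrank ℂ (LinearMap.ker M.mulVecLin) = 0 := by
      rw [Matrix.rank] at hr
      omega
    have hwk : w ∈ LinearMap.ker M.mulVecLin := hMw
    rw [Submodule.finrank_eq_zero.1 h0] at hwk
    exact hw hwk

/-! ### Zero assignment -/

theorem theorem9p1 (n r : ℕ) (A : Matrix (Fin n) (Fin n) ℝ) (B : Matrix (Fin n) (Fin r) ℝ)
    (hB : B.rank = r) (hAB : IsControllable A B)
    (s : Fin (n - r) → ℝ) (hs : Function.Injective s)
    (hsA : ∀ i, ¬ Module.End.HasEigenvalue (Matrix.toLin' A) (s i)) :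
    ∃ C : Matrix (Fin r) (Fin n) ℝ,
      (∃ k : ℝ, k ≠ 0 ∧
        zeroPolynomial A B C = Polynomial.C k * ∏ i, (Polynomial.X - Polynomial.C (s i))) ∧
      systemZeros A B C = Set.range (fun i => (s i : ℂ)) ∧
      IsObservable A B C ∧
      C.rank = r ∧
      (C * B).rank = r := by
  have hrn : r ≤ n := hB ▸ B.rank_le_height
  have hA : ∀ i x, A.mulVecLin x = s i • x → x = 0 := by
    intro i x hx
    by_contra hne
    exact hsA i (Module.End.hasEigenvalue_of_hasEigenvector
      ⟨Module.End.mem_eigenspace_iff.2 (by simpa using hx), hne⟩)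
  obtain ⟨v, u, hv, hli⟩ := exists_linearIndependent_mkQ (A := A.mulVecLin) (B := B.mulVecLin)
    (fun W hW hBW => hAB.eq_top_of_invariant W hW hBW) (n - r)
    (by
      change B.rank + (n - r) ≤ _
      rw [hB, Module.finrank_fin_fun]
      omega) s hs hA
  have hcol : LinearIndependent ℝ (fun j => B.mulVecLin (Pi.single j 1)) := by
    have hker : LinearMap.ker B.mulVecLin = ⊥ := by
      have h := B.mulVecLin.finrank_range_add_finrank_ker
      change B.rank + _ = _ at h
      rw [hB, Module.finrank_fin_fun] at h
      exact Submodule.finrank_eq_zero.1 (by omega)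
    have := (Pi.basisFun ℝ (Fin r)).linearIndependent.map' B.mulVecLin hker
    simpa [Function.comp_def] using this
  have hcolR : LinearIndependent ℝ (fun j =>
      (⟨B.mulVecLin (Pi.single j 1), _, rfl⟩ : LinearMap.range B.mulVecLin)) :=
    LinearIndependent.of_comp (LinearMap.range B.mulVecLin).subtype hcol
  have hsum := LinearIndependent.sumElim_of_quotient hcolR v hli
  let b : Basis (Fin r ⊕ Fin (n - r)) ℝ (Fin n → ℝ) :=
    basisOfLinearIndependentOfCardEqFinrank' _ hsum (by
      rw [Fintype.card_sum, Fintype.card_fin, Fintype.card_fin, Module.finrank_fin_fun]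
      omega)
  have hbl : ∀ j, b (Sum.inl j) = B.mulVecLin (Pi.single j 1) := fun j => by simp [b]
  have hbr : ∀ i, b (Sum.inr i) = v i := fun i => by simp [b]
  -- `C` reads off the coordinates along the columns of `B`.
  let c : (Fin n → ℝ) →ₗ[ℝ] (Fin r → ℝ) :=
    b.constr ℝ (Sum.elim (fun j => Pi.single j 1) (fun _ => 0))
  let C : Matrix (Fin r) (Fin n) ℝ := LinearMap.toMatrix' c
  have hCc : ∀ x, C.mulVec x = c x := fun x => LinearMap.toMatrix'_mulVec c x
  have hCv : ∀ i, C.mulVec (v i) = 0 := fun i => by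
    rw [hCc, ← hbr, Basis.constr_basis, Sum.elim_inr]
  have hCB' : C.mulVecLin ∘ₗ B.mulVecLin = LinearMap.id := by
    refine (Pi.basisFun ℝ (Fin r)).ext fun j => ?_
    rw [Pi.basisFun_apply, LinearMap.comp_apply, ← hbl, Matrix.mulVecLin_apply, hCc,
      Basis.constr_basis, Sum.elim_inl, LinearMap.id_apply]
  have hCB : C * B = 1 := by
    apply Matrix.mulVec_injective
    funext w
    rw [← Matrix.mulVec_mulVec, Matrix.one_mulVec]
    exact LinearMap.congr_fun hCB' w
  have hzero : ∃ k : ℝ, k ≠ 0 ∧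
      zeroPolynomial A B C = Polynomial.C k * ∏ i, (Polynomial.X - Polynomial.C (s i)) := by
    let e : Fin (n - r) ⊕ Fin r ≃ Fin n := finSumFinEquiv.trans (finCongr (by omega))
    let V : Matrix (Fin n) (Fin (n - r)) ℝ := Matrix.of fun i j => v j i
    obtain ⟨ρ, hdet⟩ : ∃ ρ : ℝ, (systemMatrix A B C).det * Polynomial.C ρ =
        Polynomial.C ((Matrix.fromCols V B).submatrix id e.symm).det *
          ∏ i, (Polynomial.X - Polynomial.C (s i)) :=
      ⟨_, systemMatrix_det_mul e (U := Matrix.of fun i j => u j i)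
        (fun i j => congrFun (hv j) i)
        (by
          ext i j
          exact congrFun (hCv j) i) hCB⟩
    have hT : ((Matrix.fromCols V B).submatrix id e.symm).det ≠ 0 := by
      have hli' : LinearIndependent ℝ ((Matrix.fromCols V B).submatrix id e.symm).col := by
        have h := b.linearIndependent.comp ((e.symm.trans (Equiv.sumComm _ _)))
          (Equiv.injective _)
        convert h using 1
        funext j
        obtain ⟨j, rfl⟩ := e.surjective j
        rcases j with j | j
        · simp only [Function.comp_apply, Equiv.trans_apply, Equiv.symm_apply_apply,
            Equiv.sumComm_apply, Sum.swap_inl, hbr]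
          funext i
          simp [V]
        · simp only [Function.comp_apply, Equiv.trans_apply, Equiv.symm_apply_apply,
            Equiv.sumComm_apply, Sum.swap_inr, hbl]
          funext i
          simp
      exact ((Matrix.isUnit_iff_isUnit_det _).1
        (Matrix.linearIndependent_cols_iff_isUnit.1 hli')).ne_zero
    generalize ((Matrix.fromCols V B).submatrix id e.symm).det = τ at hdet hT
    -- The right-hand side of `hdet` does not vanish, hence neither does `ρ`.
    have hρ : ρ ≠ 0 := by
      rintro rfl
      rw [Polynomial.C_0, mul_zero] at hdet
      exact mul_ne_zero (Polynomial.C_ne_zero.2 hT)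
        (Finset.prod_ne_zero_iff.2 fun i _ => Polynomial.X_sub_C_ne_zero (s i)) hdet.symm
    refine ⟨τ * ρ⁻¹, mul_ne_zero hT (inv_ne_zero hρ), ?_⟩
    have h1 : Polynomial.C ρ * Polynomial.C ρ⁻¹ = (1 : ℝ[X]) := by
      rw [← Polynomial.C_mul, mul_inv_cancel₀ hρ, Polynomial.C_1]
    calc zeroPolynomial A B C
        = (systemMatrix A B C).det * Polynomial.C ρ * Polynomial.C ρ⁻¹ := by
          rw [mul_assoc, h1, mul_one, zeroPolynomial]
      _ = _ := by
          rw [hdet, Polynomial.C_mul]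
          ring
  refine ⟨C, hzero, ?_, ?_, ?_, ?_⟩
  · obtain ⟨k, hk, hz⟩ := hzero
    ext z
    rw [mem_systemZeros_iff, hz]
    simp only [map_mul, map_prod, map_sub, Polynomial.aeval_C, Polynomial.aeval_X,
      mul_eq_zero, Finset.prod_eq_zero_iff, sub_eq_zero, Set.mem_range]
    simp [hk, eq_comm]
  · refine isObservable_of_invariant fun N hN hNC x hx => ?_
    have hexp : x = ∑ i, b.repr x (Sum.inr i) • v i := by
      have h1 := b.sum_repr x
      rw [Fintype.sum_sum_type] at h1
      have h2 : ∑ j, b.repr x (Sum.inl j) • b (Sum.inl j) =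
          B.mulVecLin (fun j => b.repr x (Sum.inl j)) := by
        conv_rhs => rw [← (Pi.basisFun ℝ (Fin r)).sum_repr (fun j => b.repr x (Sum.inl j))]
        rw [map_sum]
        simp only [map_smul, hbl, Pi.basisFun_repr, Pi.basisFun_apply]
      have h3 : (fun j => b.repr x (Sum.inl j)) = 0 := by
        have h4 := hNC x hx
        rw [← h1, h2] at h4
        simp only [hbr, Matrix.mulVec_add, Matrix.mulVec_sum, Matrix.mulVec_smul, hCv, smul_zero,
          Finset.sum_const_zero, add_zero] at h4
        exact (LinearMap.congr_fun hCB' (fun j => b.repr x (Sum.inl j))).symm.trans h4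
      rw [h2, h3, map_zero, zero_add] at h1
      simp only [hbr] at h1
      exact h1.symm
    rw [hexp]
    exact eq_zero_of_mem_invariant (C := C.mulVecLin) hA hv hCv
      (fun w => LinearMap.congr_fun hCB' w) hN hNC Finset.univ _ (hexp ▸ hx)
  · refine le_antisymm C.rank_le_height ?_
    have h := Matrix.rank_mul_le_left C B
    rwa [hCB, Matrix.rank_one, Fintype.card_fin] at h
  · rw [hCB, Matrix.rank_one, Fintype.card_fin]
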